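/- **Model.** Agents act over a set of times $\mathbb T$ and communicate by messages only. Two models are considered: the discrete one, with $\mathbb T=\mathbb N\cup\{0\}$, and the continuous one, with $\mathbb T=\mathbb R_{\ge 0}$. A *context* $\gamma$ consists of a (possibly infinite) directed graph of agents $(\mathbb I_\gamma,N_\gamma)$ with weights $b_\gamma(i,j)\in(\mathbb T\setminus\{0\})\cup\{\infty\}$ on its edges, a set of states $S_i$ for each agent $i$, a set of messages, and a set $\tilde E_\gamma$ of external inputs $\tilde e$, each observed by one agent $i_{\tilde e}$. A *protocol* $P$ specifies, for each agent, a set of initial states and a deterministic action function. The action function takes the state of the agent just before the current time $t$ and the events the agent observes at $t$ (possibly also $t$ itself), and yields a new state, a set of messages to be sent to out-neighbours, and whether the agent *responds* at $t$. A *run* of $P$ is an infinite history, including the initial states, that is consistent with $P$, and in which every external input occurs at most once, every message sent by $i$ to $j$ at $t$ is delivered exactly once, at some $t'\in\mathbb T$ with $t<t'\le t+b_\gamma(i,j)$, and only sent messages are delivered. The delivery is *early* if $t'<t+b_\gamma(i,j)$. An *ND event* is an external input or an early delivery. Write $t_e$ for the occurrence time of an event $e$ and $i_e$ for the agent that observes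 it. In the continuous model, an agent acts (and changes its state as above) only when *enabled*, i.e. at time $0$ and at suprema of nonempty sets of times at each of which it observes an event. When acting at $t$, it may also set a timer for one time $t'>t$; the timer rings at $t'$, which is an event observed by the agent, iff the agent is not enabled strictly between $t$ and $t'$. The state just before $t>0$ is given by a pseudo-limit function $\lim_i:S_i^{(-1,0)}\to S_i$, given with the context, applied to $x\mapsto r_i(t+x)$, where $r_i(s)$ is the state of $i$ at time $s$; $\lim_i$ depends only on the values of its argument in a left neighbourhood of $0$ and maps constant functions to their value. When the agent is not enabled at $t$, its state at $t$ is its state just before $t$. The context may also restrict the admissible histories of inputs and deliveries. **Causality.** In a run $r$, *syncausality* $\rightsquigarrow_r$ is the smallest transitive relation on $\mathbb I_\gamma\times\mathbb T$ with (a) $(i,t)\rightsquigarrow_r(i,t')$ for $t\le t'$, (b) $(i,t)\rightsquigarrow_r(j,t')$ whenever a message sent by $i$ at $t$ is delivered to $j$ at $t'$, and (c) $(i,t)\rightsquigarrow_r(j,t+b_\gamma(i,j))$ for every edge with $b_\gamma(i,j)<\infty$. *Bound guarantee* $\dashrightarrow_\gamma$ is the smallest transitive relation satisfying (a) and (c).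 For an event $e$, write $e\rightsquigarrow_r(i,t)$ if $(i_e,t_e)\rightsquigarrow_r(i,t)$, and similarly for $\dashrightarrow_\gamma$. For events $e,e'$, write $e\rightsquigarrow_r e'$ if $e=e'$, or if $e'$ is the delivery of a message sent by some $i$ at some $t$ with $e\rightsquigarrow_r(i,t)$. In the continuous model, the following two axioms on $P$ are assumed for all runs $r$ of $P$. *No foresight:* for all $t,d\in\mathbb T$ there is a run $r'$ of $P$ that agrees with $r$ up to and including $t$ (initial states included), in which no external input occurs after $t$ and every early delivery after $t$ takes place at least $d$ after the message was sent. *No extrasensory perception:* for every agent $i$ and time $t$ there is a run $r'$ of $P$ with the same initial states, in which the ND events (with their times) occurring up to and including $t$ are exactly the ND events $e$ of $r$ with $e\rightsquigarrow_r(i,t)$, and in which the states of $i$ and the events observed by $i$, up to and including $t$, are the same as in $r$. No such assumption is made in the discrete model. **Problem.** Let $\Delta=(\mathbb T-\mathbb T)\cup\{-\infty,\infty\}$, let $\tilde e\in\tilde E_\gamma$, let $I\subseteq\mathbb I_\gamma$, and let $\delta$ map ordered pairs of distinct elements of $I$ to $\Delta$. A run is *$\tilde e$-triggered* if $\tilde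 e$ occurs in it. $P$ *solves* $\mathrm{TCR}(\tilde e,I,\delta)$ if in each run that is not $\tilde e$-triggered no $i\in I$ responds, while in each $\tilde e$-triggered run $r$ each $i\in I$ responds exactly once, at a time denoted $\mathsf t_r(i)$, and $\mathsf t_r(j)\le\mathsf t_r(i)+\delta(i,j)$ for all distinct $i,j\in I$. Let $G_\delta$ be the directed graph on $I$ whose edges are the pairs $(i,j)$ of distinct elements with $\delta(i,j)\neq\infty$, with weights $\delta(i,j)$. A path is a tuple $p=(p_1,\dots,p_n)$ of vertices, $n\ge 1$, whose consecutive entries are edges, and $L(p)$ is the sum of the weights of its edges ($L(p)=0$ for $n=1$). A *$(p,\delta)$-traversing $\tilde e$-centipede by $t$* in a run $r$ is a tuple $(e_1,\dots,e_n)$ of ND events of $r$ such that $\tilde e\rightsquigarrow_r e_n$, and $e_{m+1}\rightsquigarrow_r e_m$ for $1\le m<n$, and, for $1\le m\le n$, $t+L(p_1,\dots,p_m)\in\mathbb T$ and $e_m\dashrightarrow_\gamma(p_m,\,t+L(p_1,\dots,p_m))$. **Theorem (Path-Traversing Centipede).** In both models, if $P$ solves $\mathrm{TCR}(\tilde e,I,\delta)$,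 then every $\tilde e$-triggered run $r$ of $P$ contains, for every path $p$ in $G_\delta$, a $(p,\delta)$-traversing $\tilde e$-centipede by $\mathsf t_r(p_1)$. -/

import Mathlib

open scoped NNReal

noncomputable section

namespace TimelyCoordination

universe u v w x y

/-! ### Time and time differences -/

/-- A set of times `T` together with the map into the group `D = T - T` of its differences. -/
class TimeDomain (T : Type) (D : outParam Type) where
  toDiff : T → D

/-- Discrete time: times are natural numbers, differences are integers. -/
instance : TimeDomain ℕ ℤ := ⟨fun n => (n : ℤ)⟩

/-- Continuous time: times are nonnegative reals, differences are reals. -/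
instance : TimeDomain ℝ≥0 ℝ := ⟨fun t => (t : ℝ)⟩

/-- The possible constraining values: differences of times, together with `-∞` and `∞`. -/
abbrev Delta (D : Type) : Type := WithBot (WithTop D)

/-- A time, seen as a (finite) element of `Delta D`. -/
def timeToDelta {T D : Type} [TimeDomain T D] (t : T) : Delta D :=
  ((TimeDomain.toDiff t : WithTop D) : WithBot (WithTop D))

/-! ### Weighted directed graphs and implementation-specs -/

/-- A weighted directed graph on `V`. Only the values of `weight` on edges matter. -/
structure WeightedDigraph (V : Type*) (W : Type*) where
  Adj : V → V → Prop
  weight : V → V → W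

namespace WeightedDigraph

variable {V W : Type*}

/-- The nonempty tuple `p` of vertices is a path. -/
def IsPath (G : WeightedDigraph V W) {n : ℕ} (p : Fin (n + 1) → V) : Prop :=
  ∀ m : Fin n, G.Adj (p m.castSucc) (p m.succ)

/-- The length of a path: the sum of the weights of its edges. -/
def length [AddCommMonoid W] (G : WeightedDigraph V W) {n : ℕ} (p : Fin (n + 1) → V) : W :=
  ∑ m : Fin n, G.weight (p m.castSucc) (p m.succ)

end WeightedDigraph

/-- The initial segment of a tuple, up to and including the entry with index `m`. -/
def initialSegment {V : Type*} {n : ℕ} (p : Fin (n + 1) → V) (m : Fin (n + 1)) :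
    Fin (m.val + 1) → V :=
  fun k => p (Fin.castLE (Nat.succ_le_of_lt m.isLt) k)

/-- Ordered pairs of distinct elements. -/
abbrev DistinctPairs (V : Type*) : Type _ := {q : V × V // q.1 ≠ q.2}

/-- `t` is an implementation of `δ`: `t j ≤ t i + δ (i, j)` for all distinct `i`, `j`. -/
def IsImplementation {T D : Type} [TimeDomain T D] [AddCommGroup D] [LinearOrder D]
    {V : Type*} (δ : DistinctPairs V → Delta D) (t : V → T) : Prop :=
  ∀ q : DistinctPairs V, timeToDelta (t q.1.2) ≤ timeToDelta (t q.1.1) + δ q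

open Classical in
/-- The weighted directed graph of `δ`: the edges are the pairs of distinct elements on which
`δ` is not `∞`, and their weights are given by `δ`. -/
def constraintGraph {D : Type} [AddCommGroup D] {V : Type*}
    (δ : DistinctPairs V → Delta D) : WeightedDigraph V (Delta D) where
  Adj i j := ∃ h : i ≠ j, δ ⟨(i, j), h⟩ ≠ ((⊤ : WithTop D) : WithBot (WithTop D))
  weight i j := if h : i ≠ j then δ ⟨(i, j), h⟩ else 0

/-! ### Contexts and events -/

/-- A context: a weighted directed graph of agents, whose weights (positive, possibly infinite)
bound the delivery times of messages, sets of states for the agents, a set of messages, and a set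
of external inputs, each of which is observed by one agent. The values of `bound` outside of
the edges are irrelevant. -/
structure Context (T : Type) [Zero T] [Preorder T] where
  Agent : Type u
  Edge : Agent → Agent → Prop
  bound : Agent → Agent → WithTop T
  bound_pos : ∀ i j, Edge i j → 0 < bound i j
  State : Agent → Type v
  Message : Type w
  Input : Type x
  observer : Input → Agent

section Environment

variable {T : Type} [AddCommMonoid T] [LinearOrder T]

/-- An event: an external input, or the delivery to `j` of a message `m` that was sent by `i` at
time `sent`. -/
inductive Event (γ : Context.{u, v, w, x} T) : Type (max u w x)
  | input (e : γ.Input) : Event γ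
  | delivery (m : γ.Message) (sent : T) (i j : γ.Agent) (h : γ.Edge i j) : Event γ

/-- The agent that observes an event. -/
def Event.agent {γ : Context.{u, v, w, x} T} : Event γ → γ.Agent
  | .input e => γ.observer e
  | .delivery _ _ _ j _ => j

/-- The evolution of the environment: for each time, the external inputs and deliveries that
take place at that time. -/
abbrev EnvHistory (γ : Context.{u, v, w, x} T) : Type (max u w x) := T → Set (Event γ)

/-- Events paired with their occurrence times. -/
abbrev TimedEvent (γ : Context.{u, v, w, x} T) : Type (max u w x) := Event γ × T

namespace EnvHistory

variable {γ : Context.{u, v, w, x} T}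

/-- The set of events, paired with their occurrence times. -/
def events (h : EnvHistory γ) : Set (TimedEvent γ) := {a | a.1 ∈ h a.2}

/-- An event is non-deterministic, when occurring at time `t`, if it is an external input or an
early delivery, i.e. a delivery strictly before the time guaranteed by the bound. -/
def IsNDAt (t : T) : Event γ → Prop
  | .input _ => True
  | .delivery _ s i j _ => (t : WithTop T) < (s : WithTop T) + γ.bound i j

/-- The set of non-deterministic events. -/
def ndEvents (h : EnvHistory γ) : Set (TimedEvent γ) := {a | a ∈ events h ∧ IsNDAt a.2 a.1}

/-- The non-deterministic events that occur no later than `t`. -/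
def ndUpTo (h : EnvHistory γ) (t : T) : Set (TimedEvent γ) := {a | a ∈ ndEvents h ∧ a.2 ≤ t}

/-- The external inputs that the agent `i` observes at time `t`. -/
def observedInputs (h : EnvHistory γ) (i : γ.Agent) (t : T) : Set {e : γ.Input // γ.observer e = i} :=
  {e | Event.input e.1 ∈ h t}

/-- The messages, paired with their senders, that are delivered to `i` at time `t`. -/
def observedMessages (h : EnvHistory γ) (i : γ.Agent) (t : T) : Set (γ.Message × γ.Agent) :=
  {a | ∃ (s : T) (hij : γ.Edge a.2 i), Event.delivery a.1 s a.2 i hij ∈ h t}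

/-- The properties required of the environment in a run, where `sent m s i j` says that `i` sends
the message `m` to `j` at time `s`: each external input occurs at most once; each message that is
sent is delivered exactly once, after it was sent and within the bound; and only messages that
were sent are delivered. -/
structure IsLegal (h : EnvHistory γ) (sent : γ.Message → T → ∀ i j : γ.Agent, γ.Edge i j → Prop) :
    Prop where
  input_once : ∀ (e : γ.Input) (t t' : T), Event.input e ∈ h t → Event.input e ∈ h t' → t = t'
  delivered : ∀ (m : γ.Message) (s : T) (i j : γ.Agent) (hij : γ.Edge i j), sent m s i j hij →
    ∃ t' : T, s < t' ∧ (t' : WithTop T) ≤ (s : WithTop T) + γ.bound i j ∧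
      ∀ t'' : T, Event.delivery m s i j hij ∈ h t'' ↔ t'' = t'
  sent_of_delivered : ∀ (m : γ.Message) (s : T) (i j : γ.Agent) (hij : γ.Edge i j) (t' : T),
    Event.delivery m s i j hij ∈ h t' → sent m s i j hij

/-- The generating steps of the syncausality relation. -/
inductive SyncStep (h : EnvHistory γ) : γ.Agent × T → γ.Agent × T → Prop
  | locality (i : γ.Agent) (t t' : T) (ht : t ≤ t') : SyncStep h (i, t) (i, t')
  | message (m : γ.Message) (i j : γ.Agent) (hij : γ.Edge i j) (t t' : T) (ht : t < t')
      (hm : Event.delivery m t i j hij ∈ h t') : SyncStep h (i, t) (j, t')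
  | guarantee (i j : γ.Agent) (hij : γ.Edge i j) (b : T) (hb : γ.bound i j = (b : WithTop T))
      (t : T) : SyncStep h (i, t) (j, t + b)

/-- The syncausality relation on agent-time pairs. -/
def Syncausal (h : EnvHistory γ) : γ.Agent × T → γ.Agent × T → Prop :=
  Relation.TransGen (SyncStep h)

/-- Syncausality between events: `a = a'`, or `a'` is the delivery of a message sent by some `i`
at some `s`, and `a` is syncausally before `(i, s)`. -/
def EventSyncausal (h : EnvHistory γ) (a a' : TimedEvent γ) : Prop :=
  a = a' ∨ ∃ (m : γ.Message) (s : T) (i j : γ.Agent) (hij : γ.Edge i j),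
    a'.1 = Event.delivery m s i j hij ∧ Syncausal h (a.1.agent, a.2) (i, s)

/-- The ND past of an agent-time pair. -/
def ndPast (h : EnvHistory γ) (θ : γ.Agent × T) : Set (TimedEvent γ) :=
  {a | a ∈ ndEvents h ∧ Syncausal h (a.1.agent, a.2) θ}

end EnvHistory

/-- The generating steps of the bound guarantee relation. -/
inductive GuaranteeStep (γ : Context.{u, v, w, x} T) : γ.Agent × T → γ.Agent × T → Prop
  | locality (i : γ.Agent) (t t' : T) (ht : t ≤ t') : GuaranteeStep γ (i, t) (i, t')
  | guarantee (i j : γ.Agent) (hij : γ.Edge i j) (b : T) (hb : γ.bound i j = (b : WithTop T))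
      (t : T) : GuaranteeStep γ (i, t) (j, t + b)

/-- The bound guarantee relation on agent-time pairs. -/
def BoundGuarantee (γ : Context.{u, v, w, x} T) : γ.Agent × T → γ.Agent × T → Prop :=
  Relation.TransGen (GuaranteeStep γ)

/-! ### Coordinated response problems -/

/-- What a coordinated response problem sees of a protocol: its runs, the evolution of the
environment in each run, and the times at which each agent responds in each run. -/
structure RunSystem (γ : Context.{u, v, w, x} T) where
  Run : Type y
  env : Run → EnvHistory γ
  Responds : Run → γ.Agent → T → Prop

namespace RunSystem

variable {γ : Context.{u, v, w, x} T}

/-- The run `r` is `e`-triggered, i.e. the external input `e` occurs in `r`. -/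
def Triggered (S : RunSystem.{u, v, w, x, y} γ) (e : γ.Input) (r : S.Run) : Prop :=
  ∃ t : T, (Event.input e, t) ∈ (S.env r).ndEvents

/-- Eventual response: in each triggered run each agent in `I` responds exactly once, and in each
other run no agent in `I` responds. -/
structure SolvesER (S : RunSystem.{u, v, w, x, y} γ) (e : γ.Input) (I : Set γ.Agent) : Prop where
  responds_once : ∀ r : S.Run, S.Triggered e r → ∀ i : I, ∃! t : T, S.Responds r i t
  no_response : ∀ r : S.Run, ¬ S.Triggered e r → ∀ (i : I) (t : T), ¬ S.Responds r i t

/-- The response time of an agent in a triggered run. -/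
def responseTime {S : RunSystem.{u, v, w, x, y} γ} {e : γ.Input} {I : Set γ.Agent}
    (hS : S.SolvesER e I) {r : S.Run} (hr : S.Triggered e r) (i : I) : T :=
  (hS.responds_once r hr i).choose

/-- Timely-coordinated response: eventual response, such that in each triggered run the response
times constitute an implementation of `δ`. -/
structure SolvesTCR {D : Type} [TimeDomain T D] [AddCommGroup D] [LinearOrder D]
    (S : RunSystem.{u, v, w, x, y} γ) (e : γ.Input) (I : Set γ.Agent)
    (δ : DistinctPairs I → Delta D) : Prop where
  er : S.SolvesER e I
  timely : ∀ (r : S.Run) (hr : S.Triggered e r), IsImplementation δ (responseTime er hr)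

end RunSystem

/-- The tuple `c` of events is a `(p, δ)`-traversing `e`-centipede by `t`. The times of the end nodes
are required to be actual times (elements of `T`). -/
structure IsTraversingCentipede {D : Type} [TimeDomain T D] [AddCommGroup D] [LinearOrder D]
    {γ : Context.{u, v, w, x} T} (h : EnvHistory γ) (e : γ.Input) {I : Set γ.Agent}
    (δ : DistinctPairs I → Delta D) {n : ℕ} (p : Fin (n + 1) → I) (t : T)
    (c : Fin (n + 1) → TimedEvent γ) : Prop where
  nd : ∀ m, c m ∈ h.ndEvents
  trigger : ∃ s : T, (Event.input e, s) ∈ h.ndEvents ∧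
    h.EventSyncausal (Event.input e, s) (c (Fin.last n))
  chain : ∀ m : Fin n, h.EventSyncausal (c m.succ) (c m.castSucc)
  legs : ∀ m : Fin (n + 1), ∃ s : T,
    timeToDelta s = timeToDelta t + (constraintGraph δ).length (initialSegment p m) ∧
    BoundGuarantee γ ((c m).1.agent, (c m).2) ((p m : γ.Agent), s)

end Environment

/-! ### The discrete-time model -/

section Discrete

/-- The actions of an agent: choosing a new state, sending messages to neighbours, and possibly
responding. -/
structure DiscreteAction (γ : Context.{u, v, w, x} ℕ) (i : γ.Agent) where
  newState : γ.State i
  sends : Set (γ.Message × {j : γ.Agent // γ.Edge i j})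
  respond : Bool

/-- A protocol: for each agent, a set of initial states and an action function, of the current
state and the currently observed events. Actions may also depend on the time (a shared clock);
protocols without a shared clock are those that ignore the argument of type `ℕ`. -/
structure DiscreteProtocol (γ : Context.{u, v, w, x} ℕ) where
  init : ∀ i : γ.Agent, Set (γ.State i)
  act : ∀ i : γ.Agent, ℕ → γ.State i → Set {e : γ.Input // γ.observer e = i} →
    Set (γ.Message × γ.Agent) → DiscreteAction γ i

/-- Candidate runs. As the initial states (which are the states just before time `0`) influence
the actions at time `0`, they are part of the run. -/
structure DiscreteHistory (γ : Context.{u, v, w, x} ℕ) where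
  env : EnvHistory γ
  initial : ∀ i : γ.Agent, γ.State i
  state : ℕ → ∀ i : γ.Agent, γ.State i

namespace DiscreteHistory

variable {γ : Context.{u, v, w, x} ℕ}

/-- The state of `i` just before a given time. -/
def stateBefore (r : DiscreteHistory γ) (i : γ.Agent) : ℕ → γ.State i
  | 0 => r.initial i
  | t + 1 => r.state t i

/-- The actions of `i` at time `t`, according to the protocol `P`. -/
def action (r : DiscreteHistory γ) (P : DiscreteProtocol γ) (i : γ.Agent) (t : ℕ) :
    DiscreteAction γ i :=
  P.act i t (r.stateBefore i t) (r.env.observedInputs i t) (r.env.observedMessages i t)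

end DiscreteHistory

namespace DiscreteProtocol

variable {γ : Context.{u, v, w, x} ℕ}

/-- `r` is a run of `P`. -/
structure IsRun (P : DiscreteProtocol γ) (r : DiscreteHistory γ) : Prop where
  initial_mem : ∀ i, r.initial i ∈ P.init i
  state_eq : ∀ i t, r.state t i = (r.action P i t).newState
  legal : r.env.IsLegal (fun m s i j hij => (m, ⟨j, hij⟩) ∈ (r.action P i s).sends)

/-- The runs of `P`, with their responses. -/
def system (P : DiscreteProtocol γ) : RunSystem γ where
  Run := {r : DiscreteHistory γ // P.IsRun r}
  env r := r.1.env
  Responds r i t := (r.1.action P i t).respond = true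

end DiscreteProtocol

end Discrete

/-! ### The continuous-time model -/

section Continuous

/-- A context of the continuous-time model. In addition to the data above it has a pseudo-limit
function for the states of each agent, which defines the state just before a given time,
and a set of admissible evolutions of the environment, which expresses possible additional
constraints on the environment (`Set.univ` if there are none). -/
structure ContinuousContext extends Context.{u, v, w, x} ℝ≥0 where
  lim : ∀ i : Agent, (Set.Ioo (-1 : ℝ) 0 → State i) → State i
  lim_congr : ∀ (i : Agent) (f g : Set.Ioo (-1 : ℝ) 0 → State i),
    (∃ ε : ℝ, 0 < ε ∧ ∀ a : Set.Ioo (-1 : ℝ) 0, -ε < a.1 → f a = g a) → lim i f = lim i g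
  lim_const : ∀ (i : Agent) (s : State i), lim i (fun _ => s) = s
  admissible : Set (EnvHistory toContext)

/-- The actions of an agent at time `t`: choosing a new state, sending messages to neighbours,
possibly setting a timer for a later time, and possibly responding. -/
structure ContinuousAction (γ : ContinuousContext.{u, v, w, x}) (i : γ.Agent) (t : ℝ≥0) where
  newState : γ.State i
  sends : Set (γ.Message × {j : γ.Agent // γ.Edge i j})
  timer : Option {t' : ℝ≥0 // t < t'}
  respond : Bool

/-- A protocol: for each agent, a set of initial states and an action function, of the time, the
state just before it, the observed inputs and messages, and whether a timer rings. Protocols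
without a shared clock are those in which the time is not used, except for setting timers a given
duration ahead. -/
structure ContinuousProtocol (γ : ContinuousContext.{u, v, w, x}) where
  init : ∀ i : γ.Agent, Set (γ.State i)
  act : ∀ (i : γ.Agent) (t : ℝ≥0), γ.State i → Set {e : γ.Input // γ.observer e = i} →
    Set (γ.Message × γ.Agent) → Prop → ContinuousAction γ i t

/-- Candidate runs. `rings t` is the set of agents whose timer rings at `t`. -/
structure ContinuousHistory (γ : ContinuousContext.{u, v, w, x}) where
  env : EnvHistory γ.toContext
  rings : ℝ≥0 → Set γ.Agent
  initial : ∀ i : γ.Agent, γ.State i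
  state : ℝ≥0 → ∀ i : γ.Agent, γ.State i

namespace ContinuousHistory

variable {γ : ContinuousContext.{u, v, w, x}}

/-- The agent `i` observes some event (input, delivery or timer ring) at `t`. -/
def ObservesAt (r : ContinuousHistory γ) (i : γ.Agent) (t : ℝ≥0) : Prop :=
  (∃ a ∈ r.env t, a.agent = i) ∨ i ∈ r.rings t

/-- The agent `i` is enabled at `t`: either `t = 0`, or `t` is a supremum of a set of times at each
of which `i` observes an event. -/
def Enabled (r : ContinuousHistory γ) (i : γ.Agent) (t : ℝ≥0) : Prop :=
  t = 0 ∨ ∃ A : Set ℝ≥0, A.Nonempty ∧ (∀ s ∈ A, r.ObservesAt i s) ∧ IsLUB A t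

open Classical in
/-- The state of `i` just before time `t`. (By `lim_congr`, the truncation of negative times to `0`
has no influence.) -/
def stateBefore (r : ContinuousHistory γ) (i : γ.Agent) (t : ℝ≥0) : γ.State i :=
  if t = 0 then r.initial i
  else γ.lim i (fun a => r.state (Real.toNNReal ((t : ℝ) + a.1)) i)

/-- The actions that `P` prescribes for `i` at `t`. (They are performed iff `i` is enabled.) -/
def action (r : ContinuousHistory γ) (P : ContinuousProtocol γ) (i : γ.Agent) (t : ℝ≥0) :
    ContinuousAction γ i t :=
  P.act i t (r.stateBefore i t) (EnvHistory.observedInputs r.env i t)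
    (EnvHistory.observedMessages r.env i t) (i ∈ r.rings t)

/-- Two histories agree up to and including time `t`. -/
def AgreeUpTo (r r' : ContinuousHistory γ) (t : ℝ≥0) : Prop :=
  r'.initial = r.initial ∧
    ∀ s ≤ t, r'.env s = r.env s ∧ r'.rings s = r.rings s ∧ r'.state s = r.state s

/-- Two histories are indistinguishable for the agent `i` up to and including time `t`: the states
of `i` and the events observed by `i` are the same. -/
def IndistinguishableUpTo (r r' : ContinuousHistory γ) (i : γ.Agent) (t : ℝ≥0) : Prop :=
  r'.initial i = r.initial i ∧
    ∀ s ≤ t, r'.state s i = r.state s i ∧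
      EnvHistory.observedInputs r'.env i s = EnvHistory.observedInputs r.env i s ∧
      EnvHistory.observedMessages r'.env i s = EnvHistory.observedMessages r.env i s ∧
      (i ∈ r'.rings s ↔ i ∈ r.rings s)

end ContinuousHistory

namespace ContinuousProtocol

variable {γ : ContinuousContext.{u, v, w, x}}

open Classical in
/-- `r` is a run of `P`. -/
structure IsRun (P : ContinuousProtocol γ) (r : ContinuousHistory γ) : Prop where
  initial_mem : ∀ i, r.initial i ∈ P.init i
  state_eq : ∀ i t, r.state t i =
    if r.Enabled i t then (r.action P i t).newState else r.stateBefore i t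
  legal : EnvHistory.IsLegal r.env
    (fun m s i j hij => r.Enabled i s ∧ (m, ⟨j, hij⟩) ∈ (r.action P i s).sends)
  rings_iff : ∀ i t, i ∈ r.rings t ↔ ∃ (t' : ℝ≥0) (ht : t' < t), r.Enabled i t' ∧
    (r.action P i t').timer = some ⟨t, ht⟩ ∧ ∀ s, t' < s → s < t → ¬ r.Enabled i s
  env_admissible : r.env ∈ γ.admissible

/-- The runs of `P`, with their responses. -/
def system (P : ContinuousProtocol γ) : RunSystem γ.toContext where
  Run := {r : ContinuousHistory γ // P.IsRun r}
  env r := r.1.env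
  Responds r i t := r.1.Enabled i t ∧ (r.1.action P i t).respond = true

/-- No foresight: each run may be continued after each time `t` without further external inputs,
and such that any message that is delivered early after `t` is delivered no less than `d` time
units after it was sent. -/
def NoForesight (P : ContinuousProtocol γ) : Prop :=
  ∀ r, P.IsRun r → ∀ t d : ℝ≥0, ∃ r', P.IsRun r' ∧ r.AgreeUpTo r' t ∧
    (∀ (e : γ.Input) (t' : ℝ≥0), t < t' → Event.input e ∉ r'.env t') ∧
    (∀ (m : γ.Message) (s : ℝ≥0) (i j : γ.Agent) (hij : γ.Edge i j) (t' : ℝ≥0), t < t' →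
      (Event.delivery m s i j hij, t') ∈ EnvHistory.ndEvents r'.env → s + d ≤ t')

/-- No extrasensory perception: for each run `r` and each `(i, t)` there is a run with the same
initial states in which the ND events up to `t` are precisely those in the ND past of `(i, t)`
in `r`, and which `i` does not distinguish from `r` up to `t`. -/
def NoExtrasensoryPerception (P : ContinuousProtocol γ) : Prop :=
  ∀ r, P.IsRun r → ∀ (t : ℝ≥0) (i : γ.Agent), ∃ r', P.IsRun r' ∧ r'.initial = r.initial ∧
    EnvHistory.ndUpTo r'.env t = EnvHistory.ndPast r.env (i, t) ∧
    r.IndistinguishableUpTo r' i t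

end ContinuousProtocol

end Continuous

end TimelyCoordination

end

namespace TimelyCoordination

universe u v w x y

/-! What an agent does at `t` depends only on the ND events in the past of that agent at `t`. Hence,
if `i` responds at `t` in `r`, there is a run `r'` in which `i` still responds at `t`, while no
external input, and up to any chosen horizon `d` no ND event at all, occurs outside that past. This
is `RespondsFromPast`, the only property of the two models that the main argument
(`SolvesTCR.exists_isTraversingCentipede`) needs besides timely delivery.

The main argument is an induction on the length of the path, over all triggered runs at once. Let `p
0` respond at `t` in `r`, and take `r'` as above with `d = t + δ (p 0, p 1)`. A response in `r'`
forces `r'` to be triggered, so `p 1` responds there, no later than `d`. The induction hypothesis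
yields a centipede in `r'` for the path without `p 0`. Its events occur by `d`, so they are ND
events of `r` in the past of `(p 0, t)`. Its causal links persist in `r`
(`EventSyncausal.transfer`): up to `d` the early deliveries of `r'` also occur in `r`, and any other
delivery can be replaced by a bound guarantee. The last ND event on a causal chain from its head to
`(p 0, t)` is the new head (`exists_nd_boundGuarantee`), and waiting stretches the other legs to the
required times.

`RespondsFromPast` follows from the two axioms in the continuous model. In the discrete model `r'`
is constructed, by delaying every delivery outside the past as long as possible. -/

/-- The embedding of times into time differences is an order embedding onto the nonnegative
differences. -/
class OrderedTimeDomain (T : Type) (D : outParam Type) [TimeDomain T D] [AddCommGroup D]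
    [LinearOrder D] [LinearOrder T] : Prop where
  toDiff_le_iff : ∀ s t : T, TimeDomain.toDiff (D := D) s ≤ TimeDomain.toDiff t ↔ s ≤ t
  toDiff_nonneg : ∀ s : T, (0 : D) ≤ TimeDomain.toDiff s
  exists_toDiff_eq : ∀ x : D, 0 ≤ x → ∃ s : T, TimeDomain.toDiff s = x

instance : OrderedTimeDomain ℕ ℤ where
  toDiff_le_iff _ _ := Nat.cast_le
  toDiff_nonneg _ := Int.natCast_nonneg _
  exists_toDiff_eq x hx := ⟨x.toNat, Int.toNat_of_nonneg hx⟩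

instance : OrderedTimeDomain ℝ≥0 ℝ where
  toDiff_le_iff _ _ := NNReal.coe_le_coe
  toDiff_nonneg s := s.2
  exists_toDiff_eq x hx := ⟨⟨x, hx⟩, rfl⟩

/-! ### Reduction of constraints with finite values to inequalities between differences of times. -/

section Delta

variable {T D : Type} [TimeDomain T D] [AddCommGroup D]

/-- The value `-∞` would make the right side `-∞`, below every time. So an edge of the constraint
graph has a finite weight as soon as there is a triggered run. -/
theorem exists_eq_coe_of_timeToDelta_le_add [LinearOrder D] {s t : T} {x : Delta D}
    (h : (timeToDelta s : Delta D) ≤ timeToDelta t + x)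
    (hx : x ≠ ((⊤ : WithTop D) : WithBot (WithTop D))) :
    ∃ a : D, x = ((a : WithTop D) : WithBot (WithTop D)) := by
  induction x using WithBot.recBotCoe with
  | bot => simp [timeToDelta] at h
  | coe x =>
    induction x using WithTop.recTopCoe with
    | top => exact absurd rfl hx
    | coe a => exact ⟨a, rfl⟩

theorem exists_eq_coe_of_timeToDelta_eq_add [LinearOrder D] {s t : T} {x : Delta D}
    (h : (timeToDelta s : Delta D) = timeToDelta t + x) :
    ∃ a : D, x = ((a : WithTop D) : WithBot (WithTop D)) := by
  refine exists_eq_coe_of_timeToDelta_le_add h.le ?_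
  rintro rfl
  rw [timeToDelta, timeToDelta, ← WithBot.coe_add, WithTop.add_top, WithBot.coe_inj] at h
  exact WithTop.coe_ne_top h

theorem timeToDelta_eq_add_coe_iff {s t : T} {a : D} :
    (timeToDelta s : Delta D) = timeToDelta t + ((a : WithTop D) : WithBot (WithTop D)) ↔
      TimeDomain.toDiff s = TimeDomain.toDiff t + a := by
  rw [timeToDelta, timeToDelta, ← WithBot.coe_add, ← WithTop.coe_add, WithBot.coe_inj,
    WithTop.coe_inj]

theorem timeToDelta_le_add_coe_iff [LinearOrder D] {s t : T} {a : D} :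
    (timeToDelta s : Delta D) ≤ timeToDelta t + ((a : WithTop D) : WithBot (WithTop D)) ↔
      TimeDomain.toDiff s ≤ TimeDomain.toDiff t + a := by
  rw [timeToDelta, timeToDelta, ← WithBot.coe_add, ← WithTop.coe_add, WithBot.coe_le_coe,
    WithTop.coe_le_coe]

end Delta

/-! ### Lengths of initial segments. -/

section Paths

variable {V W : Type*} [AddCommMonoid W]

theorem WeightedDigraph.length_initialSegment_zero (G : WeightedDigraph V W) {n : ℕ}
    (p : Fin (n + 1) → V) : G.length (initialSegment p 0) = 0 := Finset.sum_empty

/-- The first edge is split off, rather than the last, because the main induction removes `p 0`. -/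
theorem WeightedDigraph.length_initialSegment_succ (G : WeightedDigraph V W) {n : ℕ}
    (p : Fin (n + 1 + 1) → V) (m : Fin (n + 1)) :
    G.length (initialSegment p m.succ) =
      G.weight (p 0) (p 1) + G.length (initialSegment (p ∘ Fin.succ) m) := by
  unfold WeightedDigraph.length
  exact Fin.sum_univ_succ _

end Paths

/-! ### Syncausality, bound guarantees and ND events. -/

section Environment

variable {T : Type} [AddCommMonoid T] [LinearOrder T] {γ : Context.{u, v, w, x} T}

/-- Deliveries take place after the message was sent, and within the bound. -/
def EnvHistory.DeliversInTime (h : EnvHistory γ) : Prop :=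
  ∀ (m : γ.Message) (s : T) (i j : γ.Agent) (hij : γ.Edge i j) (t : T),
    Event.delivery m s i j hij ∈ h t → s < t ∧ (t : WithTop T) ≤ (s : WithTop T) + γ.bound i j

theorem EnvHistory.IsLegal.deliversInTime {h : EnvHistory γ}
    {sent : γ.Message → T → ∀ i j : γ.Agent, γ.Edge i j → Prop} (hl : h.IsLegal sent) :
    h.DeliversInTime := by
  intro m s i j hij t ht
  obtain ⟨t', h1, h2, h3⟩ := hl.delivered m s i j hij (hl.sent_of_delivered m s i j hij t ht)
  rw [(h3 t).1 ht]
  exact ⟨h1, h2⟩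

theorem EnvHistory.IsLegal.delivery_unique {h : EnvHistory γ}
    {sent : γ.Message → T → ∀ i j : γ.Agent, γ.Edge i j → Prop} (hl : h.IsLegal sent)
    {m : γ.Message} {s : T} {i j : γ.Agent} {hij : γ.Edge i j} {t t' : T}
    (ht : Event.delivery m s i j hij ∈ h t) (ht' : Event.delivery m s i j hij ∈ h t') :
    t = t' := by
  obtain ⟨t₀, -, -, h3⟩ := hl.delivered m s i j hij (hl.sent_of_delivered m s i j hij t ht)
  rw [(h3 t).1 ht, (h3 t').1 ht']

/-- A delivery that is not early takes place precisely at the guaranteed time. -/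
theorem EnvHistory.DeliversInTime.exists_bound_eq {h : EnvHistory γ} (hd : h.DeliversInTime)
    {m : γ.Message} {s : T} {i j : γ.Agent} {hij : γ.Edge i j} {t : T}
    (ht : Event.delivery m s i j hij ∈ h t)
    (hn : ¬ EnvHistory.IsNDAt t (Event.delivery m s i j hij)) :
    ∃ b : T, γ.bound i j = (b : WithTop T) ∧ t = s + b := by
  have heq := le_antisymm (hd m s i j hij t ht).2 (not_lt.1 hn)
  generalize γ.bound i j = B at heq
  induction B using WithTop.recTopCoe with
  | top => simp at heq
  | coe b => exact ⟨b, rfl, by exact_mod_cast heq⟩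

theorem BoundGuarantee.locality (i : γ.Agent) {t t' : T} (h : t ≤ t') :
    BoundGuarantee γ (i, t) (i, t') := .single (.locality i t t' h)

theorem EnvHistory.Syncausal.locality (h : EnvHistory γ) (i : γ.Agent) {t t' : T} (ht : t ≤ t') :
    h.Syncausal (i, t) (i, t') := .single (.locality i t t' ht)

/-- The last non-deterministic event of a syncausal chain. -/
theorem EnvHistory.Syncausal.exists_nd_boundGuarantee {h : EnvHistory γ} (hd : h.DeliversInTime)
    {a : TimedEvent γ} (ha : a ∈ h.ndEvents) {θ : γ.Agent × T}
    (hs : h.Syncausal (a.1.agent, a.2) θ) :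
    ∃ c ∈ h.ndEvents, h.EventSyncausal a c ∧ BoundGuarantee γ (c.1.agent, c.2) θ := by
  have key : ∀ θ' θ : γ.Agent × T, h.Syncausal (a.1.agent, a.2) θ' →
      (∃ c ∈ h.ndEvents, h.EventSyncausal a c ∧ BoundGuarantee γ (c.1.agent, c.2) θ') →
      h.SyncStep θ' θ →
      ∃ c ∈ h.ndEvents, h.EventSyncausal a c ∧ BoundGuarantee γ (c.1.agent, c.2) θ := by
    rintro _ _ hs ⟨c, hc, hac, hb⟩ (⟨i, t, t', ht⟩ | ⟨m, i, j, hij, t, t', ht, hm⟩ |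
      ⟨i, j, hij, b, hb', t⟩)
    · exact ⟨c, hc, hac, hb.tail (.locality i t t' ht)⟩
    -- An early delivery becomes the new last ND event. Any other delivery takes place at the
    -- guaranteed time and merely prolongs the bound guarantee.
    · by_cases hn : IsNDAt t' (Event.delivery m t i j hij)
      · exact ⟨(Event.delivery m t i j hij, t'), ⟨hm, hn⟩, Or.inr ⟨m, t, i, j, hij, rfl, hs⟩,
          .locality j le_rfl⟩
      · obtain ⟨b, hb', rfl⟩ := hd.exists_bound_eq hm hn
        exact ⟨c, hc, hac, hb.tail (.guarantee i j hij b hb' t)⟩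
    · exact ⟨c, hc, hac, hb.tail (.guarantee i j hij b hb' t)⟩
  have base : ∃ c ∈ h.ndEvents, h.EventSyncausal a c ∧
      BoundGuarantee γ (c.1.agent, c.2) (a.1.agent, a.2) :=
    ⟨a, ha, Or.inl rfl, .locality _ le_rfl⟩
  induction hs with
  | single hstep => exact key _ _ (.locality h _ le_rfl) base hstep
  | tail hs hstep ih => exact key _ _ hs ih hstep

section Canonical

variable [CanonicallyOrderedAdd T]

theorem EnvHistory.SyncStep.time_le {h : EnvHistory γ} {θ θ' : γ.Agent × T}
    (hs : h.SyncStep θ θ') : θ.2 ≤ θ'.2 := by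
  cases hs with
  | locality i t t' ht => exact ht
  | message m i j hij t t' ht hm => exact ht.le
  | guarantee i j hij b hb t => exact le_self_add

theorem EnvHistory.Syncausal.time_le {h : EnvHistory γ} {θ θ' : γ.Agent × T}
    (hs : h.Syncausal θ θ') : θ.2 ≤ θ'.2 := by
  induction hs with
  | single hstep => exact hstep.time_le
  | tail _ hstep ih => exact ih.trans hstep.time_le

theorem GuaranteeStep.time_le {θ θ' : γ.Agent × T} (hs : GuaranteeStep γ θ θ') :
    θ.2 ≤ θ'.2 := by
  cases hs with
  | locality i t t' ht => exact ht
  | guarantee i j hij b hb t => exact le_self_add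

theorem BoundGuarantee.time_le {θ θ' : γ.Agent × T} (hs : BoundGuarantee γ θ θ') :
    θ.2 ≤ θ'.2 := by
  induction hs with
  | single hstep => exact hstep.time_le
  | tail _ hstep ih => exact ih.trans hstep.time_le

theorem EnvHistory.EventSyncausal.time_le {h : EnvHistory γ} (hd : h.DeliversInTime)
    {a a' : TimedEvent γ} (ha' : a' ∈ h.ndEvents) (hs : h.EventSyncausal a a') :
    a.2 ≤ a'.2 := by
  obtain rfl | ⟨m, s, i, j, hij, he, hs⟩ := hs
  · exact le_rfl
  · have hmem := ha'.1
    change a'.1 ∈ h a'.2 at hmem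
    rw [he] at hmem
    exact hs.time_le.trans (hd m s i j hij _ hmem).1.le

/-- Syncausality up to time `d` is inherited by histories that contain all non-deterministic
events up to time `d`. -/
theorem EnvHistory.Syncausal.transfer {h h' : EnvHistory γ} (hd : h'.DeliversInTime) {d : T}
    (hnd : ∀ a ∈ h'.ndEvents, a.2 ≤ d → a ∈ h.ndEvents) {θ θ' : γ.Agent × T}
    (hs : h'.Syncausal θ θ') (hθ : θ'.2 ≤ d) : h.Syncausal θ θ' := by
  have key : ∀ θ θ' : γ.Agent × T, h'.SyncStep θ θ' → θ'.2 ≤ d → h.SyncStep θ θ' := by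
    rintro _ _ (⟨i, t, t', ht⟩ | ⟨m, i, j, hij, t, t', ht, hm⟩ | ⟨i, j, hij, b, hb, t⟩) hle
    · exact .locality i t t' ht
    · by_cases hn : IsNDAt t' (Event.delivery m t i j hij)
      · exact .message m i j hij t t' ht (hnd (Event.delivery m t i j hij, t') ⟨hm, hn⟩ hle).1
      -- The message need not be delivered, or even sent, in `h`, but the guarantee step is
      -- available in every history.
      · obtain ⟨b, hb, rfl⟩ := hd.exists_bound_eq hm hn
        exact .guarantee i j hij b hb t
    · exact .guarantee i j hij b hb t
  induction hs with
  | single hstep => exact .single (key _ _ hstep hθ)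
  | tail _ hstep ih => exact (ih (hstep.time_le.trans hθ)).tail (key _ _ hstep hθ)

theorem EnvHistory.EventSyncausal.transfer {h h' : EnvHistory γ} (hd : h'.DeliversInTime) {d : T}
    (hnd : ∀ a ∈ h'.ndEvents, a.2 ≤ d → a ∈ h.ndEvents) {a a' : TimedEvent γ}
    (ha' : a' ∈ h'.ndEvents) (hs : h'.EventSyncausal a a') (hle : a'.2 ≤ d) :
    h.EventSyncausal a a' := by
  obtain rfl | ⟨m, s, i, j, hij, he, hs⟩ := hs
  · exact Or.inl rfl
  · have hmem := ha'.1
    change a'.1 ∈ h' a'.2 at hmem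
    rw [he] at hmem
    exact Or.inr ⟨m, s, i, j, hij, he,
      hs.transfer hd hnd ((hd m s i j hij _ hmem).1.le.trans hle)⟩

end Canonical

/-! ### The centipede theorem for abstract systems of runs. -/

namespace RunSystem

/-- Whenever an agent responds, it also responds in some run in which all external inputs, and
all non-deterministic events up to an arbitrary time, belong to the past of the response. -/
def RespondsFromPast (S : RunSystem.{u, v, w, x, y} γ) : Prop :=
  ∀ (r : S.Run) (i : γ.Agent) (t : T), S.Responds r i t → ∀ d : T, ∃ r' : S.Run,
    S.Responds r' i t ∧ ∀ a ∈ (S.env r').ndEvents, (a.2 ≤ d ∨ ∃ e, a.1 = Event.input e) →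
      a ∈ (S.env r).ndPast (i, t)

variable {S : RunSystem.{u, v, w, x, y} γ} {e : γ.Input} {I : Set γ.Agent}

theorem responds_responseTime (hS : S.SolvesER e I) {r : S.Run} (hr : S.Triggered e r) (i : I) :
    S.Responds r i (responseTime hS hr i) :=
  (hS.responds_once r hr i).choose_spec.1

theorem SolvesER.eq_responseTime (hS : S.SolvesER e I) {r : S.Run} (hr : S.Triggered e r) {i : I}
    {t : T} (h : S.Responds r i t) : t = responseTime hS hr i :=
  (hS.responds_once r hr i).choose_spec.2 t h

theorem SolvesER.triggered (hS : S.SolvesER e I) {r : S.Run} {i : I} {t : T}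
    (h : S.Responds r i t) : S.Triggered e r :=
  by_contra fun hr => hS.no_response r hr i t h

variable {D : Type} [TimeDomain T D] [AddCommGroup D] [LinearOrder D] [IsOrderedAddMonoid D]
  [OrderedTimeDomain T D] [CanonicallyOrderedAdd T]

/-- The path-traversing centipede theorem for systems of runs. -/
theorem SolvesTCR.exists_isTraversingCentipede {δ : DistinctPairs I → Delta D}
    (hS : S.SolvesTCR e I δ) (hpast : S.RespondsFromPast)
    (hd : ∀ r : S.Run, (S.env r).DeliversInTime) (n : ℕ) :
    ∀ (r : S.Run) (hr : S.Triggered e r) (p : Fin (n + 1) → I),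
      (constraintGraph δ).IsPath p →
      ∃ c : Fin (n + 1) → TimedEvent γ,
        IsTraversingCentipede (S.env r) e δ p (responseTime hS.er hr (p 0)) c := by
  induction n with
  | zero =>
    intro r hr p _
    have hresp := responds_responseTime hS.er hr (p 0)
    -- The horizon is immaterial here: only the clause on external inputs is used, which puts the
    -- trigger into the past of the response.
    obtain ⟨r', hresp', hnd⟩ := hpast r _ _ hresp 0
    obtain ⟨s, hs⟩ := hS.er.triggered hresp'
    obtain ⟨hs1, hs2⟩ := hnd _ hs (Or.inr ⟨e, rfl⟩)
    obtain ⟨c, hc, hsc, hbc⟩ := hs2.exists_nd_boundGuarantee (hd r) hs1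
    refine ⟨fun _ => c, fun _ => hc, ⟨s, hs1, hsc⟩, fun m => m.elim0, fun m => ?_⟩
    obtain rfl : m = 0 := Fin.fin_one_eq_zero m
    exact ⟨_, by rw [WeightedDigraph.length_initialSegment_zero, add_zero], hbc⟩
  | succ n ih =>
    intro r hr p hp
    have hresp := responds_responseTime hS.er hr (p 0)
    set t := responseTime hS.er hr (p 0) with ht
    obtain ⟨hne, htop⟩ := hp 0
    have hweight : (constraintGraph δ).weight (p 0) (p 1) = δ ⟨(p 0, p 1), hne⟩ := dif_pos hne
    have htime := hS.timely r hr ⟨(p 0, p 1), hne⟩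
    obtain ⟨a, ha⟩ := exists_eq_coe_of_timeToDelta_le_add htime htop
    change δ ⟨(p 0, p 1), hne⟩ = _ at ha
    rw [ha] at hweight
    rw [ha, timeToDelta_le_add_coe_iff] at htime
    -- `d` is the deadline of `p 1` when `p 0` responds at `t`. It is a time, since it bounds the
    -- response time of `p 1` in `r` itself.
    obtain ⟨d, hd_eq⟩ := OrderedTimeDomain.exists_toDiff_eq (T := T)
      (TimeDomain.toDiff t + a) ((OrderedTimeDomain.toDiff_nonneg _).trans htime)
    obtain ⟨r', hresp', hnd⟩ := hpast r _ _ hresp d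
    have hr' : S.Triggered e r' := hS.er.triggered hresp'
    have hnd' : ∀ a ∈ (S.env r').ndEvents, a.2 ≤ d → a ∈ (S.env r).ndEvents :=
      fun a ha hle => (hnd a ha (Or.inl hle)).1
    have htime' := hS.timely r' hr' ⟨(p 0, p 1), hne⟩
    rw [ha, timeToDelta_le_add_coe_iff] at htime'
    have hresp_eq : responseTime hS.er hr' (p 0) = t := (hS.er.eq_responseTime hr' hresp').symm
    change TimeDomain.toDiff (responseTime hS.er hr' (p 1)) ≤
      TimeDomain.toDiff (responseTime hS.er hr' (p 0)) + a at htime'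
    rw [hresp_eq] at htime'
    obtain ⟨c, hc⟩ := ih r' hr' (p ∘ Fin.succ) (fun m => hp m.succ)
    change IsTraversingCentipede (S.env r') e δ (p ∘ Fin.succ)
      (responseTime hS.er hr' (p 1)) c at hc
    set t' := responseTime hS.er hr' (p 1) with ht'
    have hle0 : (c 0).2 ≤ d := by
      obtain ⟨s, hs, hb⟩ := hc.legs 0
      rw [WeightedDigraph.length_initialSegment_zero, add_zero] at hs
      have hst : TimeDomain.toDiff s = (TimeDomain.toDiff t' : D) :=
        WithTop.coe_inj.1 (WithBot.coe_inj.1 hs)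
      refine hb.time_le.trans ((OrderedTimeDomain.toDiff_le_iff s d).1 ?_)
      rw [hst, hd_eq]
      exact htime'
    -- Along the index the chain runs backwards in time, so the head `c 0` is the latest event.
    have hle : ∀ m, (c m).2 ≤ d := fun m => by
      induction m using Fin.induction with
      | zero => exact hle0
      | succ m ihm => exact ((hc.chain m).time_le (hd r') (hc.nd _)).trans ihm
    obtain ⟨hc1, hc2⟩ := hnd (c 0) (hc.nd 0) (Or.inl hle0)
    obtain ⟨c0, hc0, hsc, hbc⟩ := hc2.exists_nd_boundGuarantee (hd r) hc1
    refine ⟨Fin.cons c0 c, fun m => ?_, ?_, fun m => ?_, fun m => ?_⟩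
    · cases m using Fin.cases with
      | zero => exact hc0
      | succ m => exact hnd' _ (hc.nd m) (hle m)
    · obtain ⟨s, hs, hsc'⟩ := hc.trigger
      rw [← Fin.succ_last, Fin.cons_succ]
      exact ⟨s, (hnd _ hs (Or.inr ⟨e, rfl⟩)).1, hsc'.transfer (hd r') hnd' (hc.nd _) (hle _)⟩
    · cases m using Fin.cases with
      | zero => exact hsc
      | succ m =>
        exact (hc.chain m).transfer (hd r') hnd' (hc.nd _) (hle _)
    · cases m using Fin.cases with
      | zero =>
        exact ⟨t, by rw [WeightedDigraph.length_initialSegment_zero, add_zero], hbc⟩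
      | succ m =>
        obtain ⟨s', hs', hb⟩ := hc.legs m
        obtain ⟨l, hl⟩ := exists_eq_coe_of_timeToDelta_eq_add hs'
        rw [hl, timeToDelta_eq_add_coe_iff] at hs'
        -- In `r'` the legs are measured from `t'`, which may precede `t + a`. They therefore end no
        -- later than required, and the required end is nonnegative because `s'` is.
        have hle' : (TimeDomain.toDiff s' : D) ≤ TimeDomain.toDiff t + (a + l) := by
          rw [hs', ← add_assoc]
          gcongr
        obtain ⟨s, hs⟩ := OrderedTimeDomain.exists_toDiff_eq (T := T) _
          ((OrderedTimeDomain.toDiff_nonneg _).trans hle')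
        refine ⟨s, ?_, ?_⟩
        · rw [WeightedDigraph.length_initialSegment_succ, hweight, hl, ← WithBot.coe_add,
            ← WithTop.coe_add, timeToDelta_eq_add_coe_iff]
          exact hs
        · rw [Fin.cons_succ]
          refine hb.tail (.locality _ _ _ ?_)
          rw [← OrderedTimeDomain.toDiff_le_iff, hs]
          exact hle'

end RunSystem

end Environment

/-! ### Responses depend only on the past: continuous time. -/

section Continuous

variable {γ : ContinuousContext.{u, v, w, x}}

namespace ContinuousHistory

/-- Expresses observation through the data that `IndistinguishableUpTo` compares. -/
theorem observesAt_iff (r : ContinuousHistory γ) (i : γ.Agent) (t : ℝ≥0) :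
    r.ObservesAt i t ↔ (EnvHistory.observedInputs r.env i t).Nonempty ∨
      (EnvHistory.observedMessages r.env i t).Nonempty ∨ i ∈ r.rings t := by
  constructor
  · rintro (⟨e | ⟨m, s, k, j, hkj⟩, ha, rfl⟩ | hr)
    · exact Or.inl ⟨⟨e, rfl⟩, ha⟩
    · exact Or.inr (Or.inl ⟨(m, k), s, hkj, ha⟩)
    · exact Or.inr (Or.inr hr)
  · rintro (⟨e, he⟩ | ⟨a, s, hij, ha⟩ | hr)
    · exact Or.inl ⟨_, he, e.2⟩
    · exact Or.inl ⟨_, ha, rfl⟩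
    · exact Or.inr hr

namespace IndistinguishableUpTo

variable {r r' : ContinuousHistory γ} {i : γ.Agent} {t : ℝ≥0}

theorem observesAt_iff (h : r.IndistinguishableUpTo r' i t) {s : ℝ≥0} (hs : s ≤ t) :
    r'.ObservesAt i s ↔ r.ObservesAt i s := by
  obtain ⟨-, h1, h2, h3⟩ := h.2 s hs
  rw [ContinuousHistory.observesAt_iff, ContinuousHistory.observesAt_iff, h1, h2, h3]

/-- A set with supremum `t` contains only times up to `t`, where the observations of `i` coincide.
-/
theorem enabled (h : r.IndistinguishableUpTo r' i t) (he : r.Enabled i t) : r'.Enabled i t := by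
  obtain h0 | ⟨A, hA, hobs, hlub⟩ := he
  · exact Or.inl h0
  · exact Or.inr ⟨A, hA, fun s hs => (h.observesAt_iff (hlub.1 hs)).2 (hobs s hs), hlub⟩

theorem stateBefore_eq (h : r.IndistinguishableUpTo r' i t) :
    r'.stateBefore i t = r.stateBefore i t := by
  unfold stateBefore
  split_ifs
  · exact h.1
  · congr 1
    funext a
    refine (h.2 _ (Real.toNNReal_le_iff_le_coe.2 ?_)).1
    have := a.2.2
    linarith

theorem action_eq (h : r.IndistinguishableUpTo r' i t) (P : ContinuousProtocol γ) :
    r'.action P i t = r.action P i t := by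
  obtain ⟨-, h1, h2, h3⟩ := h.2 t le_rfl
  unfold action
  rw [h.stateBefore_eq, h1, h2, propext h3]

theorem trans {r'' : ContinuousHistory γ} (h : r.IndistinguishableUpTo r' i t)
    (h' : r'.IndistinguishableUpTo r'' i t) : r.IndistinguishableUpTo r'' i t := by
  refine ⟨h'.1.trans h.1, fun s hs => ?_⟩
  obtain ⟨h0, h1, h2, h3⟩ := h.2 s hs
  obtain ⟨h0', h1', h2', h3'⟩ := h'.2 s hs
  exact ⟨h0'.trans h0, h1'.trans h1, h2'.trans h2, h3'.trans h3⟩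

end IndistinguishableUpTo

theorem AgreeUpTo.indistinguishableUpTo {r r' : ContinuousHistory γ} {t : ℝ≥0}
    (h : r.AgreeUpTo r' t) (i : γ.Agent) : r.IndistinguishableUpTo r' i t := by
  refine ⟨by rw [h.1], fun s hs => ?_⟩
  obtain ⟨h1, h2, h3⟩ := h.2 s hs
  refine ⟨by rw [h3], ?_, ?_, by rw [h2]⟩
  · unfold EnvHistory.observedInputs
    rw [h1]
  · unfold EnvHistory.observedMessages
    rw [h1]

end ContinuousHistory

/-- No extrasensory perception removes the ND events up to `t` outside the past of `(i, t)`. No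
foresight then removes the inputs after `t` and postpones the early deliveries after `t` beyond the
horizon. Neither step is noticed by `i` up to `t`. -/
theorem ContinuousProtocol.respondsFromPast {P : ContinuousProtocol γ} (hf : P.NoForesight)
    (hp : P.NoExtrasensoryPerception) : P.system.RespondsFromPast := by
  rintro ⟨r, hr⟩ i t ⟨hen, hact⟩ d
  obtain ⟨r₁, hr₁, -, hnd, hind⟩ := hp r hr t i
  -- With a delay of `d + 1`, every early delivery after `t` comes strictly after `d`, whenever it
  -- was sent.
  obtain ⟨r₂, hr₂, hagree, hinp, hdel⟩ := hf r₁ hr₁ t (d + 1)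
  have hind₂ := hind.trans (hagree.indistinguishableUpTo i)
  refine ⟨⟨r₂, hr₂⟩, ⟨hind₂.enabled hen, ?_⟩, ?_⟩
  · change (r₂.action P i t).respond = true
    rw [hind₂.action_eq P]
    exact hact
  · rintro ⟨a, s⟩ ⟨ha, hnda⟩ hor
    change a ∈ r₂.env s at ha
    change (a, s) ∈ EnvHistory.ndPast r.env (i, t)
    have hst : s ≤ t := by
      by_contra! hts
      cases a with
      | input e => exact hinp e s hts ha
      | delivery m s₀ k j hkj =>
        have h1 := hdel m s₀ k j hkj s hts ⟨ha, hnda⟩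
        obtain hsd | ⟨e, he⟩ := hor
        · have h2 : d + 1 ≤ d := (le_add_self.trans h1).trans hsd
          exact absurd h2 (not_le.2 (lt_add_one d))
        · cases he
    rw [← hnd]
    refine ⟨⟨?_, hnda⟩, hst⟩
    rw [(hagree.2 s hst).1] at ha
    exact ha

end Continuous

/-! ### Responses depend only on the past: discrete time. -/

section Discrete

variable {γ : Context.{u, v, w, x} ℕ}

namespace EnvHistory

open Classical in
/-- The delivery time that retains the deliveries in the set `E` of events, and otherwise is the
latest possible one (or, in the absence of a bound, is after `d`). -/
noncomputable def lazyDeliveryTime (E : Set (TimedEvent γ)) (d : ℕ) (m : γ.Message) (s : ℕ) (i j : γ.Agent)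
    (hij : γ.Edge i j) : ℕ :=
  if h : ∃ t, (Event.delivery m s i j hij, t) ∈ E then h.choose
  else if h : ∃ b : ℕ, γ.bound i j = WithTop.some b then s + h.choose
  else max s d + 1

section LazyDeliveryTime

variable {E : Set (TimedEvent γ)} {d : ℕ} {m : γ.Message} {s : ℕ} {i j : γ.Agent}
  {hij : γ.Edge i j}

theorem lazyDeliveryTime_mem {t : ℕ} (h : (Event.delivery m s i j hij, t) ∈ E) :
    (Event.delivery m s i j hij, lazyDeliveryTime E d m s i j hij) ∈ E := by
  have h' : ∃ t, (Event.delivery m s i j hij, t) ∈ E := ⟨t, h⟩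
  rw [lazyDeliveryTime, dif_pos h']
  exact h'.choose_spec

theorem lazyDeliveryTime_of_bound {b : ℕ} (h : ∀ t, (Event.delivery m s i j hij, t) ∉ E)
    (hb : γ.bound i j = WithTop.some b) : lazyDeliveryTime E d m s i j hij = s + b := by
  have h' : ∃ b : ℕ, γ.bound i j = WithTop.some b := ⟨b, hb⟩
  rw [lazyDeliveryTime, dif_neg (not_exists.2 h), dif_pos h',
    WithTop.coe_injective (h'.choose_spec.symm.trans hb)]

theorem lazyDeliveryTime_of_top (h : ∀ t, (Event.delivery m s i j hij, t) ∉ E)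
    (hb : γ.bound i j = ⊤) : lazyDeliveryTime E d m s i j hij = max s d + 1 := by
  rw [lazyDeliveryTime, dif_neg (not_exists.2 h), dif_neg]
  rintro ⟨b, hb'⟩
  exact WithTop.coe_ne_top (hb'.symm.trans hb)

/-- Deliveries retained from `E` inherit both inequalities from `h`. The others are after the
sending because bounds are positive. -/
theorem lazyDeliveryTime_spec {h : EnvHistory γ} (hd : h.DeliversInTime) (hE : E ⊆ h.events) :
    s < lazyDeliveryTime E d m s i j hij ∧
      (lazyDeliveryTime E d m s i j hij : WithTop ℕ) ≤ (s : WithTop ℕ) + γ.bound i j := by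
  by_cases hex : ∃ t, (Event.delivery m s i j hij, t) ∈ E
  · obtain ⟨t, ht⟩ := hex
    exact hd _ _ _ _ _ _ (hE (lazyDeliveryTime_mem ht))
  · rw [not_exists] at hex
    have hpos := γ.bound_pos i j hij
    cases hb : γ.bound i j using WithTop.recTopCoe with
    | top =>
      rw [lazyDeliveryTime_of_top hex hb]
      exact ⟨by omega, by simp⟩
    | coe b =>
      rw [hb] at hpos
      have hpos' : 0 < b := WithTop.coe_lt_coe.1 hpos
      rw [lazyDeliveryTime_of_bound hex hb]
      exact ⟨by omega, WithTop.coe_le_coe.2 le_rfl⟩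

/-- Deliveries at the lazy delivery time that do not belong to `E` are either not early, or
after `d`. -/
theorem lazyDeliveryTime_mem_of_nd (hle : lazyDeliveryTime E d m s i j hij ≤ d)
    (hnd : IsNDAt (lazyDeliveryTime E d m s i j hij) (Event.delivery m s i j hij)) :
    (Event.delivery m s i j hij, lazyDeliveryTime E d m s i j hij) ∈ E := by
  by_cases hex : ∃ t, (Event.delivery m s i j hij, t) ∈ E
  · exact lazyDeliveryTime_mem hex.choose_spec
  · rw [not_exists] at hex
    exfalso
    cases hb : γ.bound i j using WithTop.recTopCoe with
    | top =>
      rw [lazyDeliveryTime_of_top hex hb] at hle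
      omega
    | coe b =>
      rw [lazyDeliveryTime_of_bound hex hb] at hnd
      change ((s + b : ℕ) : WithTop ℕ) < (s : WithTop ℕ) + γ.bound i j at hnd
      rw [hb] at hnd
      exact lt_irrefl (s + b) (WithTop.coe_lt_coe.1 hnd)

end LazyDeliveryTime

end EnvHistory

/-! ### The lazy run. -/

namespace DiscreteProtocol

open EnvHistory

/-- The actions of `P` when the external inputs are those in `E`, and the deliveries take place at
the lazy delivery times. -/
noncomputable def lazyAction (P : DiscreteProtocol γ) (init : ∀ i : γ.Agent, γ.State i)
    (E : Set (TimedEvent γ)) (d : ℕ) (t : ℕ) (k : γ.Agent) : DiscreteAction γ k :=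
  P.act k t
    (match t with
      | 0 => init k
      | t' + 1 => (lazyAction P init E d t' k).newState)
    {e | (Event.input e.1, t) ∈ E}
    {a | ∃ s, ∃ _ : s < t, ∃ hij : γ.Edge a.2 k,
      (a.1, ⟨k, hij⟩) ∈ (lazyAction P init E d s a.2).sends ∧
        lazyDeliveryTime E d a.1 s a.2 k hij = t}
termination_by t

/-- The history with the actions `lazyAction`. -/
noncomputable def lazyHistory (P : DiscreteProtocol γ) (init : ∀ i : γ.Agent, γ.State i)
    (E : Set (TimedEvent γ)) (d : ℕ) : DiscreteHistory γ where
  env t := {a | match a with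
    | .input e => (Event.input e, t) ∈ E
    | .delivery m s i j hij => (m, ⟨j, hij⟩) ∈ (lazyAction P init E d s i).sends ∧
        lazyDeliveryTime E d m s i j hij = t}
  initial := init
  state t i := (lazyAction P init E d t i).newState

variable {P : DiscreteProtocol γ} {init : ∀ i : γ.Agent, γ.State i} {E : Set (TimedEvent γ)}
  {d : ℕ}

theorem delivery_mem_lazyHistory {m : γ.Message} {s : ℕ} {i j : γ.Agent} {hij : γ.Edge i j}
    {t : ℕ} : Event.delivery m s i j hij ∈ (P.lazyHistory init E d).env t ↔
      (m, ⟨j, hij⟩) ∈ (P.lazyAction init E d s i).sends ∧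
        lazyDeliveryTime E d m s i j hij = t := Iff.rfl

/-- The condition `s < t` in `lazyAction`, there to make the recursion well-founded, excludes no
delivery: by `lazyDeliveryTime_spec`, lazy deliveries come after the sending. -/
theorem action_lazyHistory {h : EnvHistory γ} (hd : h.DeliversInTime) (hE : E ⊆ h.events)
    (i : γ.Agent) (t : ℕ) :
    (P.lazyHistory init E d).action P i t = P.lazyAction init E d t i := by
  rw [lazyAction.eq_def, DiscreteHistory.action]
  congr 1
  ext a
  constructor
  · rintro ⟨s, hij, ha⟩
    rw [delivery_mem_lazyHistory] at ha
    exact ⟨s, ha.2 ▸ (lazyDeliveryTime_spec hd hE).1, hij, ha⟩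
  · rintro ⟨s, -, hij, ha⟩
    exact ⟨s, hij, ha⟩

/-- `E` need not be realised in full: a delivery in `E` occurs only if its message is sent in the
lazy history. -/
theorem isRun_lazyHistory {r : DiscreteHistory γ} (hr : P.IsRun r) (hE : E ⊆ r.env.events) :
    P.IsRun (P.lazyHistory r.initial E d) := by
  have hd := hr.legal.deliversInTime
  refine ⟨hr.initial_mem, fun i t => ?_, ?_, ?_, ?_⟩
  · rw [action_lazyHistory hd hE]
    rfl
  · intro e t t' ht ht'
    exact hr.legal.input_once e t t' (hE ht) (hE ht')
  · intro m s i j hij hs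
    rw [action_lazyHistory hd hE] at hs
    refine ⟨lazyDeliveryTime E d m s i j hij, (lazyDeliveryTime_spec hd hE).1,
      (lazyDeliveryTime_spec hd hE).2, fun t => ?_⟩
    rw [delivery_mem_lazyHistory]
    exact ⟨fun h => h.2.symm, fun h => ⟨hs, h.symm⟩⟩
  · intro m s i j hij t ht
    rw [action_lazyHistory hd hE]
    exact ht.1

/-- The lazy history that retains the non-deterministic past of `(i, t)` has the same actions in
that past. -/
theorem lazyAction_eq_of_syncausal {r : DiscreteHistory γ} (hr : P.IsRun r) {i : γ.Agent} {t : ℕ}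
    (htd : t ≤ d) (s : ℕ) : ∀ k : γ.Agent, r.env.Syncausal (k, s) (i, t) →
      P.lazyAction r.initial (r.env.ndPast (i, t)) d s k = r.action P k s := by
  have hd := hr.legal.deliversInTime
  induction s using Nat.strong_induction_on with
  | _ s ih =>
    intro k hk
    rw [lazyAction.eq_def, DiscreteHistory.action]
    congr 1
    · cases s with
      | zero => rfl
      | succ s =>
        change (P.lazyAction r.initial (r.env.ndPast (i, t)) d s k).newState = r.state s k
        rw [ih s s.lt_succ_self k
          ((Syncausal.locality r.env k s.le_succ).trans hk), hr.state_eq]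
    · ext ⟨e, rfl⟩
      exact ⟨fun h => h.1.1, fun h => ⟨⟨h, trivial⟩, hk⟩⟩
    · ext ⟨m, i'⟩
      constructor
      · rintro ⟨s₀, hs₀, hij, hsend, htime⟩
        refine ⟨s₀, hij, ?_⟩
        dsimp only at hij hsend htime ⊢
        by_cases hex : ∃ t', (Event.delivery m s₀ i' k hij, t') ∈ r.env.ndPast (i, t)
        · obtain ⟨t', ht'⟩ := hex
          have := (lazyDeliveryTime_mem (d := d) ht').1.1
          rw [htime] at this
          exact this
        · rw [not_exists] at hex
          cases hb : γ.bound i' k using WithTop.recTopCoe with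
          | top =>
            -- Such a delivery would come after `d`, whereas `s ≤ t ≤ d`.
            rw [lazyDeliveryTime_of_top hex hb] at htime
            have : s ≤ t := hk.time_le
            omega
          | coe b =>
            rw [lazyDeliveryTime_of_bound hex hb] at htime
            subst htime
            -- The guarantee step alone puts the sending into the past of `(i, t)`, so the message
            -- is also sent in `r`.
            rw [ih s₀ hs₀ i' (.head (.guarantee i' k hij b hb s₀) hk)] at hsend
            obtain ⟨t', -, hle, hiff⟩ := hr.legal.delivered m s₀ i' k hij hsend
            rw [hb] at hle
            have hle' : t' ≤ s₀ + b := WithTop.coe_le_coe.1 hle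
            obtain hlt | rfl := hle'.lt_or_eq
            -- An early delivery in `r` would precede `(k, s₀ + b)`, hence belong to the ND past,
            -- where the message has no delivery.
            · refine absurd ⟨⟨(hiff t').2 rfl, ?_⟩,
                (Syncausal.locality r.env k hle').trans hk⟩ (hex t')
              change (t' : WithTop ℕ) < (s₀ : WithTop ℕ) + γ.bound i' k
              rw [hb]
              exact WithTop.coe_lt_coe.2 hlt
            · exact (hiff _).2 rfl
      · rintro ⟨s₀, hij, hmem⟩
        dsimp only at hij hmem
        have hlt := (hd _ _ _ _ _ _ hmem).1
        refine ⟨s₀, hlt, hij, ?_, ?_⟩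
        · dsimp only
          rw [ih s₀ hlt i' (.head (.message m i' k hij s₀ s hlt hmem) hk)]
          exact hr.legal.sent_of_delivered _ _ _ _ _ _ hmem
        · dsimp only
          by_cases hex : ∃ t', (Event.delivery m s₀ i' k hij, t') ∈ r.env.ndPast (i, t)
          · obtain ⟨t', ht'⟩ := hex
            exact hr.legal.delivery_unique (lazyDeliveryTime_mem (d := d) ht').1.1 hmem
          · rw [not_exists] at hex
            -- A delivery at `(k, s)` that is not retained cannot be early, so it takes place
            -- exactly at the bound, as in the lazy history.
            obtain ⟨b, hb, hs⟩ := hd.exists_bound_eq hmem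
              fun hn => hex s ⟨⟨hmem, hn⟩, hk⟩
            rw [lazyDeliveryTime_of_bound hex hb, hs]

theorem respondsFromPast (P : DiscreteProtocol γ) : P.system.RespondsFromPast := by
  rintro ⟨r, hr⟩ i t hresp d
  have hE : r.env.ndPast (i, t) ⊆ r.env.events := fun a ha => ha.1.1
  -- The horizon must reach `t` so that `i` still acts as in `r`, and `d` so that no further ND
  -- event occurs by `d`.
  refine ⟨⟨P.lazyHistory r.initial (r.env.ndPast (i, t)) (max t d), isRun_lazyHistory hr hE⟩,
    ?_, ?_⟩
  · change (DiscreteHistory.action _ P i t).respond = true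
    rw [action_lazyHistory hr.legal.deliversInTime hE,
      lazyAction_eq_of_syncausal hr (le_max_left t d) t i (.locality r.env i le_rfl)]
    exact hresp
  · rintro ⟨a, s⟩ ⟨ha, hnd⟩ hor
    cases a with
    | input e => exact ha
    | delivery m s₀ k j hkj =>
      obtain hle | ⟨e, he⟩ := hor
      · obtain ⟨-, rfl⟩ := ha
        exact lazyDeliveryTime_mem_of_nd (hle.trans (le_max_right t d)) hnd
      · cases he

end DiscreteProtocol

end Discrete

end TimelyCoordination

theorem mainTheorem1 :
    (∀ (γ : TimelyCoordination.Context ℕ) (e : γ.Input) (I : Set γ.Agent)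
        (δ : TimelyCoordination.DistinctPairs I → TimelyCoordination.Delta ℤ)
        (P : TimelyCoordination.DiscreteProtocol γ) (hP : P.system.SolvesTCR e I δ)
        (r : P.system.Run) (hr : P.system.Triggered e r)
        (n : ℕ) (p : Fin (n + 1) → I),
        (TimelyCoordination.constraintGraph δ).IsPath p →
        ∃ c : Fin (n + 1) → TimelyCoordination.TimedEvent γ,
          TimelyCoordination.IsTraversingCentipede (P.system.env r) e δ p
            (TimelyCoordination.RunSystem.responseTime hP.er hr (p 0)) c) ∧
    (∀ (γ : TimelyCoordination.ContinuousContext) (e : γ.Input) (I : Set γ.Agent)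
        (δ : TimelyCoordination.DistinctPairs I → TimelyCoordination.Delta ℝ)
        (P : TimelyCoordination.ContinuousProtocol γ)
        (_ : P.NoForesight) (_ : P.NoExtrasensoryPerception)
        (hP : P.system.SolvesTCR e I δ)
        (r : P.system.Run) (hr : P.system.Triggered e r)
        (n : ℕ) (p : Fin (n + 1) → I),
        (TimelyCoordination.constraintGraph δ).IsPath p →
        ∃ c : Fin (n + 1) → TimelyCoordination.TimedEvent γ.toContext,
          TimelyCoordination.IsTraversingCentipede (P.system.env r) e δ p
            (TimelyCoordination.RunSystem.responseTime hP.er hr (p 0)) c) := by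
  constructor
  · intro γ e I δ P hP r hr n p hp
    exact hP.exists_isTraversingCentipede P.respondsFromPast
      (fun r => r.2.legal.deliversInTime) n r hr p hp
  · intro γ e I δ P hf hn hP r hr n p hp
    exact hP.exists_isTraversingCentipede
      (TimelyCoordination.ContinuousProtocol.respondsFromPast hf hn)
      (fun r => r.2.legal.deliversInTime) n r hr p hp
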